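/- Let $M$ be a closed, oriented Riemannian manifold of even dimension $2m$ with a spin structure, let $S$ be its spinor bundle (of complex rank $2^m$) and $L^2(M,S)$ the Hilbert space of square integrable spinors. Let $\gamma^a$ ($a=0,\dots,2m-1$) be the self-adjoint Dirac matrices in the chiral representation, $\gamma^a\gamma^b+\gamma^b\gamma^a=2\delta^{ab}$, let $\gamma$ be the grading (chirality), and let $\mathcal J$ be the real structure of $L^2(M,S)$, that is, the antiunitary operator of charge conjugation, which acts in local spin frames as $\psi\mapsto C\bar\psi$, where $C$ is the product of the $\gamma^a$ with $a$ even if $m$ is even and the product of those with $a$ odd if $m$ is odd. (In this representation, $\gamma^a$ is a real matrix for $a$ even and an imaginary one for $a$ odd; $C$ is the charge conjugation matrix, determined up to a phase by unitarity and $C\,\overline{\gamma^a}=-\gamma^aC$.) The algebra $C^\infty(M)\otimes\mathbb C^2$ of pairs $a=(f,g)$ of smooth complex functions, with involution $a^*=(\bar f,\bar g)$ and the automorphism $\rho(f,g)=(g,f)$, acts on $L^2(M,S)$ by $\pi(a)=f\,\frac{1+\gamma}{2}+g\,\frac{1-\gamma}{2}$. Put $a^+=\rho(a)^*$; an element $u$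 of the algebra is called $\rho$-unitary if $u^+u=uu^+=1$. Let $\gamma^0$ also denote the bounded operator on $L^2(M,S)$ given by Clifford multiplication by $E_0$, where $E_0$ is any Borel measurable field of unit tangent vectors on $M$ (the first vector of an orthonormal frame). For a bounded operator $\mathcal O$ on $L^2(M,S)$ put $\rho(\mathcal O)=\gamma^0\mathcal O\gamma^0$ and $\mathcal O^+=\rho(\mathcal O)^\dagger$; the operator $\mathcal O$ is called $\rho$-unitary if $\mathcal O^+\mathcal O=\mathcal O\mathcal O^+=\mathbb I$. Then, for every $\rho$-unitary $u$ of $C^\infty(M)\otimes\mathbb C^2$, the operator $\mathrm{Ad}(u)=\pi(u)\,\mathcal J\,\pi(u)\,\mathcal J^{-1}$ is $\rho$-unitary on $L^2(M,S)$. -/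

import Mathlib

open MeasureTheory Bundle
open scoped Manifold ContDiff

noncomputable section

namespace TwistedSpin

set_option linter.unusedSectionVars false

/-! ### Dirac matrices, grading and charge conjugation on `ℂ^(2^m)` -/

/-- Index set of the components of a Dirac spinor in dimension `2m`; it has `2^m` elements. -/
def SpinorIndex : ℕ → Type
  | 0 => Unit
  | m + 1 => Fin 2 × SpinorIndex m

instance instFintypeSpinorIndex : (m : ℕ) → Fintype (SpinorIndex m)
  | 0 => inferInstanceAs (Fintype Unit)
  | m + 1 =>
    letI := instFintypeSpinorIndex m
    inferInstanceAs (Fintype (Fin 2 × SpinorIndex m))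

instance instDecidableEqSpinorIndex : (m : ℕ) → DecidableEq (SpinorIndex m)
  | 0 => inferInstanceAs (DecidableEq Unit)
  | m + 1 =>
    letI := instDecidableEqSpinorIndex m
    inferInstanceAs (DecidableEq (Fin 2 × SpinorIndex m))

/-- Complex square matrices of size `2^m`. -/
abbrev SpinorMat (m : ℕ) : Type := Matrix (SpinorIndex m) (SpinorIndex m) ℂ

/-- The fibre `ℂ^(2^m)` of Dirac spinors with its standard Hermitian product. -/
abbrev Spinor (m : ℕ) : Type := EuclideanSpace ℂ (SpinorIndex m)

/-- The Pauli matrix `σ₁`. -/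
def pauli1 : Matrix (Fin 2) (Fin 2) ℂ := !![0, 1; 1, 0]

/-- The Pauli matrix `σ₂`. -/
def pauli2 : Matrix (Fin 2) (Fin 2) ℂ := !![0, -Complex.I; Complex.I, 0]

/-- The Pauli matrix `σ₃`. -/
def pauli3 : Matrix (Fin 2) (Fin 2) ℂ := !![1, 0; 0, -1]

/-- `s ⊗ A`, i.e. the `2 × 2` block matrix with blocks `s i j • A`. -/
def kron {m : ℕ} (s : Matrix (Fin 2) (Fin 2) ℂ) (A : SpinorMat m) : SpinorMat (m + 1) :=
  Matrix.kronecker s A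

/-- The grading `γ = σ₃ ⊗ 1 = diag(1, -1)` (blocks of size `2^(m-1)`) in the chiral representation;
it is `(-i)^m γ^0 ⋯ γ^(2m-1)` for the Dirac matrices below. -/
def grading : (m : ℕ) → SpinorMat m
  | 0 => 1
  | _ + 1 => kron pauli3 1

/-- The Euclidean Dirac matrices `γ^0, …, γ^(2m-1)` in the chiral representation
(only the indices `j < 2m` are relevant):
`γ^0 = σ₁ ⊗ 1`, `γ^j = σ₂ ⊗ β^(j-1)` for `0 < j < 2m - 1` and `γ^(2m-1) = σ₂ ⊗ β`, with `β^j`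
and `β` the Dirac matrices and the grading in dimension `2m - 2`. In dimension `4` these are
`γ^0 = σ₁ ⊗ 1` and `γ^j = σ₂ ⊗ σ_j`. -/
def gamma : (m : ℕ) → ℕ → SpinorMat m
  | 0, _ => 1
  | _ + 1, 0 => kron pauli1 1
  | m + 1, j + 1 => kron pauli2 (if j < 2 * m then gamma m j else grading m)

/-- The charge conjugation matrix `C`: the product of the `m` real Dirac matrices (those of even
index) if `m` is even, and of the `m` imaginary ones (those of odd index) if `m` is odd.
Charge conjugation of spinors is `x ↦ C x̄`. -/
def chargeMat (m : ℕ) : SpinorMat m :=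
  ((List.range m).map fun k => gamma m (2 * k + m % 2)).prod

section MatrixLemmas

lemma kron_mul {m : ℕ} (s t : Matrix (Fin 2) (Fin 2) ℂ) (A B : SpinorMat m) :
    kron s A * kron t B = kron (s * t) (A * B) :=
  (Matrix.mul_kronecker_mul s t A B).symm

lemma kron_neg_left {m : ℕ} (s : Matrix (Fin 2) (Fin 2) ℂ) (A : SpinorMat m) :
    kron (-s) A = -kron s A := by
  ext ⟨i, j⟩ ⟨k, l⟩
  exact neg_mul (s i k) (A j l)

lemma kron_neg_right {m : ℕ} (s : Matrix (Fin 2) (Fin 2) ℂ) (A : SpinorMat m) :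
    kron s (-A) = -kron s A := by
  ext ⟨i, j⟩ ⟨k, l⟩
  exact mul_neg (s i k) (A j l)

lemma kron_one {m : ℕ} : kron (m := m) 1 1 = 1 := Matrix.one_kronecker_one

lemma kron_conjTranspose {m : ℕ} (s : Matrix (Fin 2) (Fin 2) ℂ) (A : SpinorMat m) :
    (kron s A).conjTranspose = kron s.conjTranspose A.conjTranspose :=
  Matrix.conjTranspose_kronecker s A

lemma kron_map_star {m : ℕ} (s : Matrix (Fin 2) (Fin 2) ℂ) (A : SpinorMat m) :
    (kron s A).map star = kron (s.map star) (A.map star) := by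
  ext ⟨i, j⟩ ⟨k, l⟩
  exact star_mul' (s i k) (A j l)

lemma pauli1_sq : pauli1 * pauli1 = 1 := by
  ext i j; fin_cases i <;> fin_cases j <;> simp [pauli1, Matrix.mul_apply]
lemma pauli2_sq : pauli2 * pauli2 = 1 := by
  ext i j; fin_cases i <;> fin_cases j <;> simp [pauli2, Matrix.mul_apply]
lemma pauli3_sq : pauli3 * pauli3 = 1 := by
  ext i j; fin_cases i <;> fin_cases j <;> simp [pauli3, Matrix.mul_apply]
lemma pauli12 : pauli1 * pauli2 = -(pauli2 * pauli1) := by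
  ext i j; fin_cases i <;> fin_cases j <;> simp [pauli1, pauli2, Matrix.mul_apply]
lemma pauli31 : pauli3 * pauli1 = -(pauli1 * pauli3) := by
  ext i j; fin_cases i <;> fin_cases j <;> simp [pauli1, pauli3, Matrix.mul_apply]
lemma pauli32 : pauli3 * pauli2 = -(pauli2 * pauli3) := by
  ext i j; fin_cases i <;> fin_cases j <;> simp [pauli2, pauli3, Matrix.mul_apply]
lemma pauli1_conj : pauli1.conjTranspose = pauli1 := by
  ext i j; fin_cases i <;> fin_cases j <;> simp [pauli1]
lemma pauli2_conj : pauli2.conjTranspose = pauli2 := by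
  ext i j; fin_cases i <;> fin_cases j <;> simp [pauli2]
lemma pauli3_conj : pauli3.conjTranspose = pauli3 := by
  ext i j; fin_cases i <;> fin_cases j <;> simp [pauli3]
lemma pauli1_star : pauli1.map star = pauli1 := by
  ext i j; fin_cases i <;> fin_cases j <;> simp [pauli1]
lemma pauli2_star : pauli2.map star = -pauli2 := by
  ext i j; fin_cases i <;> fin_cases j <;> simp [pauli2]
lemma pauli3_star : pauli3.map star = pauli3 := by
  ext i j; fin_cases i <;> fin_cases j <;> simp [pauli3]

lemma one_map_star {n : Type*} [DecidableEq n] : (1 : Matrix n n ℂ).map star = 1 := by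
  ext i j; by_cases h : i = j <;> simp [Matrix.one_apply, h]

lemma grading_sq (m : ℕ) : grading m * grading m = 1 := by
  cases m with
  | zero => simp [grading]
  | succ m => simp [grading, kron_mul, pauli3_sq, kron_one]

lemma grading_conjTranspose (m : ℕ) : (grading m).conjTranspose = grading m := by
  cases m with
  | zero => simp [grading]
  | succ m => simp [grading, kron_conjTranspose, pauli3_conj]

lemma grading_star (m : ℕ) : (grading m).map star = grading m := by
  cases m with
  | zero => exact one_map_star
  | succ m => rw [grading, kron_map_star, pauli3_star, one_map_star]

lemma gamma_sq (m j : ℕ) : gamma m j * gamma m j = 1 := by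
  induction m generalizing j with
  | zero => simp [gamma]
  | succ m ih =>
    cases j with
    | zero => simp [gamma, kron_mul, pauli1_sq, kron_one]
    | succ j =>
      rw [gamma, kron_mul, pauli2_sq]
      split_ifs
      · rw [ih, kron_one]
      · rw [grading_sq, kron_one]

lemma gamma_conjTranspose (m j : ℕ) : (gamma m j).conjTranspose = gamma m j := by
  induction m generalizing j with
  | zero => simp [gamma]
  | succ m ih =>
    cases j with
    | zero => simp [gamma, kron_conjTranspose, pauli1_conj]
    | succ j =>
      rw [gamma, kron_conjTranspose, pauli2_conj]
      split_ifs
      · rw [ih]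
      · rw [grading_conjTranspose]

lemma grading_gamma (m j : ℕ) (hj : j < 2 * m) :
    grading m * gamma m j = -(gamma m j * grading m) := by
  cases m with
  | zero => omega
  | succ m =>
    cases j with
    | zero => simp [gamma, grading, kron_mul, pauli31, kron_neg_left]
    | succ j => simp [gamma, grading, kron_mul, pauli32, kron_neg_left]

lemma gamma_anticomm (m i j : ℕ) (hi : i < 2 * m) (hj : j < 2 * m) (hij : i ≠ j) :
    gamma m i * gamma m j = -(gamma m j * gamma m i) := by
  induction m generalizing i j with
  | zero => omega
  | succ m ih =>
    cases i with
    | zero =>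
      cases j with
      | zero => omega
      | succ j => simp [gamma, kron_mul, pauli12, kron_neg_left]
    | succ i =>
      cases j with
      | zero => simp [gamma, kron_mul, pauli12, kron_neg_left]
      | succ j =>
        simp only [gamma, kron_mul, ← kron_neg_right]
        congr 1
        split_ifs with h1 h2 h2
        · exact ih i j h1 h2 (by omega)
        · rw [grading_gamma m i h1, neg_neg]
        · rw [grading_gamma m j h2]
        · omega

lemma gamma_star (m j : ℕ) (hj : j < 2 * m) : (gamma m j).map star = (-1 : ℂ) ^ j • gamma m j := by
  induction m generalizing j with
  | zero => omega
  | succ m ih =>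
    cases j with
    | zero => rw [gamma, kron_map_star, pauli1_star, one_map_star, pow_zero, one_smul]
    | succ j =>
      rw [gamma, kron_map_star, pauli2_star, kron_neg_left, pow_succ, mul_neg_one, neg_smul]
      congr 1
      split_ifs with h
      · rw [ih j h]
        exact Matrix.kronecker_smul _ _ _
      · have : j = 2 * m := by omega
        subst this
        rw [grading_star, pow_mul, neg_one_sq, one_pow, one_smul]

/-- The sign with which `gamma m a` and `gamma m b` commute. -/
lemma gamma_comm (m i j : ℕ) (hi : i < 2 * m) (hj : j < 2 * m) :
    gamma m i * gamma m j = (if i = j then (1 : ℂ) else -1) • (gamma m j * gamma m i) := by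
  split_ifs with h
  · simp [h]
  · simp [gamma_anticomm m i j hi hj h]

lemma prod_gamma_comm (m j k : ℕ) (hk : k ≤ m) (hj : j < 2 * m) :
    ((List.range k).map fun k => gamma m (2 * k + m % 2)).prod * gamma m j =
      (∏ i ∈ Finset.range k, if 2 * i + m % 2 = j then (1 : ℂ) else -1) •
      (gamma m j * ((List.range k).map fun k => gamma m (2 * k + m % 2)).prod) := by
  induction k with
  | zero => simp
  | succ k ih =>
    rw [List.range_succ, List.map_append, List.prod_append, List.map_singleton, List.prod_singleton,
      mul_assoc, gamma_comm m _ j (by omega) hj, mul_smul_comm, ← mul_assoc, ih (by omega),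
      Finset.prod_range_succ, smul_mul_assoc, smul_smul, mul_assoc, mul_comm (ite _ _ _)]

lemma sign_prod (m j : ℕ) (hj : j < 2 * m) :
    (∏ i ∈ Finset.range m, if 2 * i + m % 2 = j then (1 : ℂ) else -1) * (-1) ^ j = -1 := by
  by_cases h : j % 2 = m % 2
  · have hj2 : j / 2 ∈ Finset.range m := by simp; omega
    rw [← Finset.mul_prod_erase _ _ hj2, if_pos (by omega),
      Finset.prod_congr rfl (g := fun _ => (-1 : ℂ))]
    · rw [Finset.prod_const, Finset.card_erase_of_mem hj2, Finset.card_range, one_mul, ← pow_add]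
      exact Odd.neg_one_pow (by rw [Nat.odd_iff]; omega)
    · intro i hi
      rw [Finset.mem_erase] at hi
      rw [if_neg (by omega)]
  · rw [Finset.prod_congr rfl (g := fun _ => (-1 : ℂ))]
    · rw [Finset.prod_const, Finset.card_range, ← pow_add]
      exact Odd.neg_one_pow (by rw [Nat.odd_iff]; omega)
    · intro i _
      rw [if_neg (by omega)]

/-- Charge conjugation anticommutes with every Dirac matrix: `C conj(γ^j) = - γ^j C`. -/
lemma chargeMat_gamma (m j : ℕ) (hj : j < 2 * m) :
    chargeMat m * (gamma m j).map star = -(gamma m j * chargeMat m) := by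
  rw [gamma_star m j hj, mul_smul_comm, chargeMat, prod_gamma_comm m j m le_rfl hj, smul_smul,
    mul_comm, sign_prod m j hj, neg_smul, one_smul]

lemma chargeMat_unitary (m : ℕ) :
    chargeMat m * (chargeMat m).conjTranspose = 1 := by
  have : ∀ L : List ℕ, (L.map fun k => gamma m (2 * k + m % 2)).prod *
      ((L.map fun k => gamma m (2 * k + m % 2)).prod).conjTranspose = 1 := by
    intro L
    induction L with
    | nil => simp
    | cons a L ih =>
      rw [List.map_cons, List.prod_cons, Matrix.conjTranspose_mul, gamma_conjTranspose, mul_assoc,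
        ← mul_assoc (List.prod _), ih, one_mul, gamma_sq]
  exact this _

lemma chargeMat_unitary' (m : ℕ) : (chargeMat m).conjTranspose * chargeMat m = 1 :=
  mul_eq_one_comm.mp (chargeMat_unitary m)

end MatrixLemmas

/-! ### The spin representation -/

/-- The Euclidean quadratic form `x ↦ ∑ xₐ²` on `ℝⁿ`. -/
def euclideanForm (n : ℕ) : QuadraticForm ℝ (Fin n → ℝ) :=
  QuadraticMap.weightedSumSquares ℝ (fun _ => (1 : ℝ))

/-- Clifford multiplication `γ(x) = ∑ₐ xₐ γ^a` by a vector `x` of `ℝ^(2m)`. -/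
def cliffordMul (m : ℕ) : (Fin (2 * m) → ℝ) →ₗ[ℝ] SpinorMat m where
  toFun x := ∑ a, (x a : ℂ) • gamma m a
  map_add' x y := by simp [add_smul, Finset.sum_add_distrib]
  map_smul' r x := by simp [Finset.smul_sum, mul_smul]

lemma cliffordMul_sq (m : ℕ) (x : Fin (2 * m) → ℝ) :
    cliffordMul m x * cliffordMul m x =
      algebraMap ℝ (SpinorMat m) (euclideanForm (2 * m) x) := by
  have h1 : cliffordMul m x * cliffordMul m x =
      ∑ a, ∑ b, ((x a : ℂ) * x b) • (gamma m a * gamma m b) := by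
    simp only [cliffordMul, LinearMap.coe_mk, AddHom.coe_mk, Finset.sum_mul_sum, smul_mul_smul_comm]
  have h2 : cliffordMul m x * cliffordMul m x =
      ∑ a, ∑ b, ((x a : ℂ) * x b) • (gamma m b * gamma m a) := by
    rw [h1, Finset.sum_comm]
    simp only [mul_comm]
  have h3 : cliffordMul m x * cliffordMul m x + cliffordMul m x * cliffordMul m x =
      (2 : ℂ) • ((∑ a, (x a : ℂ) * x a) • (1 : SpinorMat m)) := by
    nth_rewrite 1 [h1]
    rw [h2, ← Finset.sum_add_distrib, Finset.sum_smul, Finset.smul_sum]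
    refine Finset.sum_congr rfl fun a _ => ?_
    rw [← Finset.sum_add_distrib, Finset.sum_eq_single a]
    · rw [gamma_sq, two_smul]
    · intro b _ hb
      rw [gamma_anticomm m a b a.2 b.2 (fun h => hb (Fin.ext h).symm), smul_neg, neg_add_cancel]
    · simp
  have h4 : cliffordMul m x * cliffordMul m x = (∑ a, (x a : ℂ) * x a) • (1 : SpinorMat m) := by
    rw [← two_smul ℂ] at h3
    exact smul_right_injective _ (two_ne_zero' ℂ) h3
  rw [h4, Algebra.algebraMap_eq_smul_one]
  ext i j
  simp [euclideanForm, QuadraticMap.weightedSumSquares_apply, Matrix.smul_apply]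

/-- The spin representation of the real Clifford algebra of `ℝ^(2m)` (with `γ(x)² = |x|²`). -/
def spinRep (m : ℕ) : CliffordAlgebra (euclideanForm (2 * m)) →ₐ[ℝ] SpinorMat m :=
  CliffordAlgebra.lift _ ⟨cliffordMul m, cliffordMul_sq m⟩

/-- The group `Spin(2m)`. -/
abbrev Spin (m : ℕ) : Type := spinGroup (euclideanForm (2 * m))

section SpinLemmas
open CliffordAlgebra

lemma spinRep_ι (m : ℕ) (x : Fin (2 * m) → ℝ) : spinRep m (ι _ x) = cliffordMul m x :=
  lift_ι_apply _ _ _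

lemma cliffordMul_conjTranspose (m : ℕ) (x : Fin (2 * m) → ℝ) :
    (cliffordMul m x).conjTranspose = cliffordMul m x := by
  simp [cliffordMul, Matrix.conjTranspose_sum, Matrix.conjTranspose_smul, gamma_conjTranspose]

lemma spinRep_reverse (m : ℕ) (x : CliffordAlgebra (euclideanForm (2 * m))) :
    spinRep m (reverse x) = (spinRep m x).conjTranspose := by
  induction x using CliffordAlgebra.induction with
  | algebraMap r =>
    rw [reverse.commutes, AlgHom.commutes, Algebra.algebraMap_eq_smul_one,
      Matrix.conjTranspose_smul]
    simp
  | ι x => rw [reverse_ι, spinRep_ι, cliffordMul_conjTranspose]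
  | mul a b ha hb => rw [reverse.map_mul, map_mul, ha, hb, map_mul, Matrix.conjTranspose_mul]
  | add a b ha hb => rw [map_add, map_add, ha, hb, map_add, Matrix.conjTranspose_add]

lemma spinRep_grading (m : ℕ) (x : CliffordAlgebra (euclideanForm (2 * m))) :
    grading m * spinRep m x = spinRep m (involute x) * grading m := by
  induction x using CliffordAlgebra.induction with
  | algebraMap r => simp [Algebra.algebraMap_eq_smul_one]
  | ι x =>
    rw [involute_ι, map_neg, spinRep_ι]
    simp only [cliffordMul, LinearMap.coe_mk, AddHom.coe_mk, Finset.mul_sum, Finset.sum_mul, neg_mul,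
      ← Finset.sum_neg_distrib, mul_smul_comm, smul_mul_assoc]
    exact Finset.sum_congr rfl fun a _ => by rw [grading_gamma m a a.2, smul_neg]
  | mul a b ha hb => rw [map_mul, ← mul_assoc, ha, mul_assoc, hb, map_mul, map_mul, mul_assoc]
  | add a b ha hb => rw [map_add, mul_add, ha, hb, map_add, map_add, add_mul]

lemma spinRep_charge (m : ℕ) (x : CliffordAlgebra (euclideanForm (2 * m))) :
    chargeMat m * (spinRep m x).map star = spinRep m (involute x) * chargeMat m := by
  have hsum : ∀ A B : SpinorMat m, (A + B).map star = A.map star + B.map star := fun A B => by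
    ext; simp
  have hmul : ∀ A B : SpinorMat m, (A * B).map star = A.map star * B.map star := fun A B => by
    ext; simp [Matrix.mul_apply]
  induction x using CliffordAlgebra.induction with
  | algebraMap r =>
    have : (algebraMap ℝ (SpinorMat m) r).map star = algebraMap ℝ (SpinorMat m) r := by
      ext i j
      by_cases h : i = j <;> simp [Matrix.algebraMap_matrix_apply, h]
    rw [AlgHom.commutes, this, AlgHom.commutes, AlgHom.commutes]
    exact (Algebra.commutes r _).symm
  | ι x =>
    rw [involute_ι, map_neg, spinRep_ι]
    have : (cliffordMul m x).map star = ∑ a, (x a : ℂ) • (gamma m a).map star := by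
      ext i j
      simp [cliffordMul, Matrix.sum_apply]
    rw [this]
    simp only [cliffordMul, LinearMap.coe_mk, AddHom.coe_mk, Finset.mul_sum, Finset.sum_mul, neg_mul,
      ← Finset.sum_neg_distrib, mul_smul_comm, smul_mul_assoc]
    exact Finset.sum_congr rfl fun a _ => by rw [chargeMat_gamma m a a.2, smul_neg]
  | mul a b ha hb =>
    rw [map_mul, hmul, ← mul_assoc, ha, mul_assoc, hb, map_mul, map_mul, mul_assoc]
  | add a b ha hb => rw [map_add, hsum, mul_add, ha, hb, map_add, map_add, add_mul]

lemma spinRep_star (m : ℕ) (h : Spin m) :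
    spinRep m (star (h : CliffordAlgebra (euclideanForm (2 * m)))) =
      (spinRep m h).conjTranspose := by
  rw [star_def, spinGroup.involute_eq h.2, spinRep_reverse]

lemma spinRep_unitary (m : ℕ) (h : Spin m) :
    (spinRep m h).conjTranspose * spinRep m h = 1 := by
  rw [← spinRep_star, ← map_mul, spinGroup.star_mul_self_of_mem h.2, map_one]

end SpinLemmas

/-! ### Riemannian spin manifolds of dimension `2m` -/

/-- The model space `ℝ^(2m)`. -/
abbrev ModelSpace (m : ℕ) : Type := EuclideanSpace ℝ (Fin (2 * m))

section Manifold

variable {m : ℕ} {M : Type*} [TopologicalSpace M] [ChartedSpace (ModelSpace m) M]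
  [IsManifold 𝓘(ℝ, ModelSpace m) ∞ M]
  [RiemannianBundle (fun p : M => TangentSpace 𝓘(ℝ, ModelSpace m) p)]

/-- The coefficients `g_{μν}` of the metric in the chart at `x`, at the point with coordinates
`y`. -/
def metricMatrix (x : M) (y : ModelSpace m) : Matrix (Fin (2 * m)) (Fin (2 * m)) ℝ :=
  Matrix.of fun μ ν =>
    inner ℝ
      (mfderiv 𝓘(ℝ, ModelSpace m) 𝓘(ℝ, ModelSpace m) (chartAt (ModelSpace m) x).symm y
        (EuclideanSpace.single μ (1 : ℝ)) :
        TangentSpace 𝓘(ℝ, ModelSpace m) ((chartAt (ModelSpace m) x).symm y))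
      (mfderiv 𝓘(ℝ, ModelSpace m) 𝓘(ℝ, ModelSpace m) (chartAt (ModelSpace m) x).symm y
        (EuclideanSpace.single ν (1 : ℝ)))

/-- The Riemannian volume measure on the domain of the chart at `x` (extended by `0`):
`√(det g_{μν}) dx^1 ⋯ dx^(2m)`. -/
def chartVolume [MeasurableSpace M] (x : M) : Measure M :=
  Measure.map (chartAt (ModelSpace m) x).symm
    ((volume.restrict (chartAt (ModelSpace m) x).target).withDensity
      fun y => ENNReal.ofReal (Real.sqrt (metricMatrix x y).det))

variable (m M) in
/-- The Riemannian volume measure of `M`. The measures `chartVolume x` agree on the overlaps of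
charts, so their supremum is the measure that restricts to `chartVolume x` on each chart domain. -/
def riemannianVolume [MeasurableSpace M] : Measure M := ⨆ x : M, chartVolume (m := m) x

variable (m M) in
/-- An orientation and a spin structure on the Riemannian manifold `M`, presented by local
trivialisations (indexed by `ι`): an open cover by domains of smooth orthonormal frames, together
with a lift of the transition functions between these frames to a `Spin(2m)`-valued cocycle. Since
`Spin(2m)` covers `SO(2m)`, all frames define the same orientation. -/
structure SpinStructure (ι : Type*) where
  /-- the open cover -/
  U : ι → Set M
  isOpen_U : ∀ i, IsOpen (U i)
  cover : ∀ p, ∃ i, p ∈ U i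
  /-- the frame `e_{i,a}` over `U i` (with junk values outside of `U i`) -/
  frame : ι → (a : Fin (2 * m)) → (p : M) → TangentSpace 𝓘(ℝ, ModelSpace m) p
  smooth_frame : ∀ i a, ContMDiffOn 𝓘(ℝ, ModelSpace m) 𝓘(ℝ, ModelSpace m).tangent ∞
    (fun p => (⟨p, frame i a p⟩ : TangentBundle 𝓘(ℝ, ModelSpace m) M)) (U i)
  orthonormal_frame : ∀ i, ∀ p ∈ U i, Orthonormal ℝ (fun a => frame i a p)
  /-- the transition functions `h_{ij} : U i ∩ U j → Spin(2m)` -/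
  trans : ι → ι → M → Spin m
  continuous_trans : ∀ i j, ContinuousOn
    (fun p => spinRep m (trans i j p : CliffordAlgebra (euclideanForm (2 * m)))) (U i ∩ U j)
  /-- `h_{ij}` acts on `ℝ^(2m)`, by `x ↦ h x h⁻¹` in the Clifford algebra, as the change of frame
  `e_{j,a} = ∑_b ⟨e_{i,b}, e_{j,a}⟩ e_{i,b}`. -/
  lift : ∀ i j, ∀ p ∈ U i ∩ U j, ∀ a,
    (trans i j p : CliffordAlgebra (euclideanForm (2 * m))) *
        CliffordAlgebra.ι (euclideanForm (2 * m)) (Pi.single a 1) *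
        ((trans i j p)⁻¹ : Spin m) =
      CliffordAlgebra.ι (euclideanForm (2 * m)) (fun b => inner ℝ (frame i b p) (frame j a p))
  cocycle : ∀ i j k, ∀ p ∈ U i ∩ U j ∩ U k, trans i j p * trans j k p = trans i k p

end Manifold

/-! ### Square integrable spinors -/

section SpinorFields

variable {m : ℕ} {M : Type*} [TopologicalSpace M] [ChartedSpace (ModelSpace m) M]
  [IsManifold 𝓘(ℝ, ModelSpace m) ∞ M]
  [RiemannianBundle (fun p : M => TangentSpace 𝓘(ℝ, ModelSpace m) p)]
  {ι : Type*} (S : SpinStructure m M ι)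

namespace SpinStructure

/-- The action of the transition function `h_{ij}(p)` on spinors. -/
def spinTrans (i j : ι) (p : M) : Spinor m →L[ℂ] Spinor m :=
  Matrix.toEuclideanCLM (𝕜 := ℂ)
    (spinRep m (S.trans i j p : CliffordAlgebra (euclideanForm (2 * m))))

/-- Some trivialisation around `p`. -/
def index (p : M) : ι := (S.cover p).choose

lemma mem_index (p : M) : p ∈ S.U (S.index p) := (S.cover p).choose_spec

lemma inner_spinTrans (i j : ι) (p : M) (x y : Spinor m) :
    inner ℂ (S.spinTrans i j p x) (S.spinTrans i j p y) = inner ℂ x y := by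
  rw [← ContinuousLinearMap.adjoint_inner_right, ← ContinuousLinearMap.star_eq_adjoint, spinTrans,
    ← map_star, ← mul_apply_eq_comp, ← map_mul, Matrix.star_eq_conjTranspose,
    spinRep_unitary, map_one, one_apply_eq_self]

/-- A spinor field, i.e. a section of the spinor bundle `Spin(M) ×_{Spin(2m)} ℂ^(2^m)`, is given by
its components `ψ i : U i → ℂ^(2^m)` in the local trivialisations (extended by `0` outside of
`U i`), which satisfy `ψ i = h_{ij} ψ j` on `U i ∩ U j`. -/
def IsSpinorField (ψ : ι → M → Spinor m) : Prop :=
  (∀ i, ∀ p ∉ S.U i, ψ i p = 0) ∧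
    ∀ i j, ∀ p ∈ S.U i ∩ S.U j, ψ i p = S.spinTrans i j p (ψ j p)

/-- The Hermitian product `⟨ψ(p), φ(p)⟩` in the fibre of the spinor bundle at `p`; it can be computed
in any trivialisation around `p`. -/
def fibreInner (ψ φ : ι → M → Spinor m) (p : M) : ℂ :=
  inner ℂ (ψ (S.index p) p) (φ (S.index p) p)

lemma fibreInner_eq {ψ φ : ι → M → Spinor m} (hψ : S.IsSpinorField ψ) (hφ : S.IsSpinorField φ)
    {p : M} {i : ι} (hi : p ∈ S.U i) : S.fibreInner ψ φ p = inner ℂ (ψ i p) (φ i p) := by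
  rw [fibreInner, hψ.2 _ i p ⟨S.mem_index p, hi⟩, hφ.2 _ i p ⟨S.mem_index p, hi⟩,
    inner_spinTrans]

variable [MeasurableSpace M]

/-- Measurable spinor fields with `∫ |ψ|² dvol < ∞`. -/
structure IsL2Field (ψ : ι → M → Spinor m) : Prop where
  isSpinorField : S.IsSpinorField ψ
  measurable : ∀ i, Measurable (ψ i)
  lintegral_lt_top : ∫⁻ p, ‖ψ (S.index p) p‖ₑ ^ 2 ∂(riemannianVolume m M) < ⊤

variable [BorelSpace M] [CompactSpace M]

/-- A function that is measurable on each `U i` is measurable. -/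
lemma measurable_of_local {β : Type*} [MeasurableSpace β] {F : M → β} (G : ι → M → β)
    (hG : ∀ i, Measurable (G i)) (hFG : ∀ i, ∀ p ∈ S.U i, F p = G i p) : Measurable F := by
  obtain ⟨t, ht⟩ := isCompact_univ.elim_finite_subcover S.U S.isOpen_U
    (fun p _ => Set.mem_iUnion.2 (S.cover p))
  intro A hA
  have : F ⁻¹' A = ⋃ i ∈ t, (S.U i ∩ G i ⁻¹' A) := by
    ext p
    simp only [Set.mem_preimage, Set.mem_iUnion, Set.mem_inter_iff, exists_prop]
    constructor
    · intro hp
      obtain ⟨i, hi, hpi⟩ := Set.mem_iUnion₂.1 (ht (Set.mem_univ p))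
      exact ⟨i, hi, hpi, hFG i p hpi ▸ hp⟩
    · rintro ⟨i, _, hpi, h⟩
      rw [hFG i p hpi]; exact h
  rw [this]
  exact Finset.measurableSet_biUnion _ fun i _ => (S.isOpen_U i).measurableSet.inter (hG i hA)

variable {S}

lemma measurable_fibreInner {ψ φ : ι → M → Spinor m} (hψ : S.IsL2Field ψ) (hφ : S.IsL2Field φ) :
    Measurable (S.fibreInner ψ φ) :=
  S.measurable_of_local (fun i p => inner ℂ (ψ i p) (φ i p))
    (fun i => (hψ.measurable i).inner (hφ.measurable i))
    fun _ _ hi => S.fibreInner_eq hψ.isSpinorField hφ.isSpinorField hi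

lemma measurable_sq {ψ : ι → M → Spinor m} (hψ : S.IsSpinorField ψ) (hm : ∀ i, Measurable (ψ i)) :
    Measurable fun p => ‖ψ (S.index p) p‖ₑ ^ 2 := by
  refine S.measurable_of_local (fun i p => ‖ψ i p‖ₑ ^ 2) (fun i => (hm i).enorm.pow_const 2) ?_
  intro i p hi
  have h := S.fibreInner_eq hψ hψ hi
  rw [fibreInner, inner_self_eq_norm_sq_to_K, inner_self_eq_norm_sq_to_K] at h
  have h' : ‖ψ (S.index p) p‖ = ‖ψ i p‖ := by
    have := (pow_left_inj₀ (norm_nonneg _) (norm_nonneg _) two_ne_zero).1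
      (by exact_mod_cast h : ‖ψ (S.index p) p‖ ^ 2 = ‖ψ i p‖ ^ 2)
    exact this
  rw [← ofReal_norm, ← ofReal_norm, h']

lemma IsL2Field.add {ψ φ : ι → M → Spinor m} (hψ : S.IsL2Field ψ) (hφ : S.IsL2Field φ) :
    S.IsL2Field (ψ + φ) where
  isSpinorField := by
    refine ⟨fun i p hp => ?_, fun i j p hp => ?_⟩
    · simp [hψ.isSpinorField.1 i p hp, hφ.isSpinorField.1 i p hp]
    · simp [hψ.isSpinorField.2 i j p hp, hφ.isSpinorField.2 i j p hp]
  measurable i := (hψ.measurable i).add (hφ.measurable i)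
  lintegral_lt_top := by
    refine lt_of_le_of_lt (lintegral_mono (g := fun p =>
      2 * (‖ψ (S.index p) p‖ₑ ^ 2 + ‖φ (S.index p) p‖ₑ ^ 2)) fun p => ?_) ?_
    · have h1 : ‖(ψ + φ) (S.index p) p‖ ^ 2 ≤
          2 * (‖ψ (S.index p) p‖ ^ 2 + ‖φ (S.index p) p‖ ^ 2) :=
        (pow_le_pow_left₀ (norm_nonneg _) (norm_add_le _ _) 2).trans add_sq_le
      have h2 := ENNReal.ofReal_le_ofReal h1
      rw [ENNReal.ofReal_mul (by positivity), ENNReal.ofReal_add (by positivity) (by positivity),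
        ENNReal.ofReal_pow (by positivity), ENNReal.ofReal_pow (by positivity),
        ENNReal.ofReal_pow (by positivity)] at h2
      simpa only [ofReal_norm, ENNReal.ofReal_ofNat] using h2
    · rw [lintegral_const_mul' _ _ (by simp),
        lintegral_add_left (measurable_sq hψ.isSpinorField hψ.measurable)]
      exact ENNReal.mul_lt_top (by simp)
        (ENNReal.add_lt_top.2 ⟨hψ.lintegral_lt_top, hφ.lintegral_lt_top⟩)

lemma IsL2Field.smul {ψ : ι → M → Spinor m} (c : ℂ) (hψ : S.IsL2Field ψ) :
    S.IsL2Field (c • ψ) where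
  isSpinorField := by
    refine ⟨fun i p hp => ?_, fun i j p hp => ?_⟩
    · simp [hψ.isSpinorField.1 i p hp]
    · simp [hψ.isSpinorField.2 i j p hp]
  measurable i := (hψ.measurable i).const_smul c
  lintegral_lt_top := by
    have : ∀ p, ‖(c • ψ) (S.index p) p‖ₑ ^ 2 = ‖c‖ₑ ^ 2 * ‖ψ (S.index p) p‖ₑ ^ 2 := fun p => by
      rw [Pi.smul_apply, Pi.smul_apply, enorm_smul, mul_pow]
    simp only [this]
    rw [lintegral_const_mul _ (measurable_sq hψ.isSpinorField hψ.measurable)]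
    exact ENNReal.mul_lt_top (by simp) hψ.lintegral_lt_top

lemma integrable_fibreInner {ψ φ : ι → M → Spinor m} (hψ : S.IsL2Field ψ) (hφ : S.IsL2Field φ) :
    Integrable (S.fibreInner ψ φ) (riemannianVolume m M) := by
  refine ⟨(measurable_fibreInner hψ hφ).aestronglyMeasurable, ?_⟩
  refine lt_of_le_of_lt (lintegral_mono (g := fun p =>
      (‖ψ (S.index p) p‖ₑ ^ 2 + ‖φ (S.index p) p‖ₑ ^ 2)) fun p => ?_) ?_
  · have h1 : ‖S.fibreInner ψ φ p‖ ≤ ‖ψ (S.index p) p‖ ^ 2 + ‖φ (S.index p) p‖ ^ 2 := by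
      refine (norm_inner_le_norm _ _).trans ?_
      nlinarith [sq_nonneg (‖ψ (S.index p) p‖ - ‖φ (S.index p) p‖),
        sq_nonneg (‖ψ (S.index p) p‖ + ‖φ (S.index p) p‖)]
    have h2 := ENNReal.ofReal_le_ofReal h1
    rw [ENNReal.ofReal_add (by positivity) (by positivity), ENNReal.ofReal_pow (by positivity),
      ENNReal.ofReal_pow (by positivity)] at h2
    simpa only [ofReal_norm] using h2
  · rw [lintegral_add_left (measurable_sq hψ.isSpinorField hψ.measurable)]
    exact ENNReal.add_lt_top.2 ⟨hψ.lintegral_lt_top, hφ.lintegral_lt_top⟩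

variable (S)

/-- The vector space of measurable square integrable spinor fields. -/
def l2Submodule : Submodule ℂ (ι → M → Spinor m) where
  carrier := {ψ | S.IsL2Field ψ}
  add_mem' := IsL2Field.add
  zero_mem' := ⟨⟨by simp, by simp⟩, fun _ => measurable_const, by simp⟩
  smul_mem' c _ h := IsL2Field.smul c h

/-- The space of measurable square integrable spinor fields, with the positive semidefinite
Hermitian form `⟨ψ, φ⟩ = ∫ ⟨ψ(p), φ(p)⟩ dvol(p)`. -/
def L2Field : Type _ := S.l2Submodule

instance : AddCommGroup S.L2Field := inferInstanceAs (AddCommGroup S.l2Submodule)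
instance : Module ℂ S.L2Field := inferInstanceAs (Module ℂ S.l2Submodule)

instance : PreInnerProductSpace.Core ℂ S.L2Field where
  inner ψ φ := ∫ p, S.fibreInner ψ.1 φ.1 p ∂(riemannianVolume m M)
  conj_inner_symm ψ φ := by
    rw [← integral_conj]
    simp [fibreInner]
  re_inner_nonneg ψ := by
    refine (integral_re (integrable_fibreInner ψ.2 ψ.2)).symm ▸ ?_
    exact integral_nonneg fun p => inner_self_nonneg
  add_left ψ φ χ := by
    rw [← integral_add (integrable_fibreInner ψ.2 χ.2) (integrable_fibreInner φ.2 χ.2)]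
    exact integral_congr_ae (.of_forall fun p => inner_add_left _ _ _)
  smul_left ψ φ c := by
    rw [← integral_const_mul]
    exact integral_congr_ae (.of_forall fun p => inner_smul_left _ _ _)

instance : SeminormedAddCommGroup S.L2Field :=
  InnerProductSpace.Core.toSeminormedAddCommGroup (𝕜 := ℂ)

instance : InnerProductSpace ℂ S.L2Field := .ofCore _

/-- The Hilbert space `L²(M, S)` of square integrable spinors: the Hausdorff completion of the
space of measurable square integrable spinor fields, in which fields that agree almost everywhere
are identified. -/
abbrev L2 : Type _ := UniformSpace.Completion S.L2Field

end SpinStructure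
end SpinorFields

/-! ### Operators on square integrable spinors that act fibrewise -/

section Operators

variable {m : ℕ} {M : Type*} [TopologicalSpace M] [ChartedSpace (ModelSpace m) M]
  [IsManifold 𝓘(ℝ, ModelSpace m) ∞ M]
  [RiemannianBundle (fun p : M => TangentSpace 𝓘(ℝ, ModelSpace m) p)]
  {ι : Type*} (S : SpinStructure m M ι) [MeasurableSpace M]

/-- A measurable, bounded field of (`σ`-semi)linear maps of the fibres of the spinor
bundle, given in the local trivialisations (with junk values outside of `U i`). -/
structure FibreOp (σ : ℂ →+* ℂ) where
  /-- the map of the fibre at `p`, in the trivialisation `i` -/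
  toFun : ι → M → Spinor m →ₛₗ[σ] Spinor m
  equivariant : ∀ i j, ∀ p ∈ S.U i ∩ S.U j, ∀ x,
    toFun i p (S.spinTrans i j p x) = S.spinTrans i j p (toFun j p x)
  measurable : ∀ i (ψ : M → Spinor m), Measurable ψ → (∀ p ∉ S.U i, ψ p = 0) →
    Measurable fun p => toFun i p (ψ p)
  bounded : ∃ K : ℝ, ∀ i, ∀ p ∈ S.U i, ∀ x, ‖toFun i p x‖ ≤ K * ‖x‖

variable {S} {σ : ℂ →+* ℂ}

lemma FibreOp.isL2Field (T : FibreOp S σ) {ψ : ι → M → Spinor m} (hψ : S.IsL2Field ψ) :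
    S.IsL2Field fun i p => T.toFun i p (ψ i p) where
  isSpinorField := by
    refine ⟨fun i p hp => ?_, fun i j p hp => ?_⟩
    · change T.toFun i p (ψ i p) = 0
      rw [hψ.isSpinorField.1 i p hp, map_zero]
    · change T.toFun i p (ψ i p) = S.spinTrans i j p (T.toFun j p (ψ j p))
      rw [hψ.isSpinorField.2 i j p hp, T.equivariant i j p hp]
  measurable i := T.measurable i _ (hψ.measurable i) (hψ.isSpinorField.1 i)
  lintegral_lt_top := by
    obtain ⟨K, hK⟩ := T.bounded
    refine lt_of_le_of_lt (lintegral_mono (g := fun p =>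
      ENNReal.ofReal (K ^ 2) * ‖ψ (S.index p) p‖ₑ ^ 2) fun p => ?_) ?_
    · have h := pow_le_pow_left₀ (norm_nonneg _)
        (hK (S.index p) p (S.mem_index p) (ψ (S.index p) p)) 2
      rw [mul_pow] at h
      have h2 := ENNReal.ofReal_le_ofReal h
      rw [ENNReal.ofReal_mul (sq_nonneg K), ENNReal.ofReal_pow (norm_nonneg _),
        ENNReal.ofReal_pow (norm_nonneg (ψ _ _))] at h2
      simpa only [ofReal_norm] using h2
    · rw [lintegral_const_mul' _ _ ENNReal.ofReal_ne_top]
      exact ENNReal.mul_lt_top ENNReal.ofReal_lt_top hψ.lintegral_lt_top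

variable [BorelSpace M] [CompactSpace M]

lemma L2Field_ext {ψ φ : S.L2Field} (h : ∀ i p, ψ.1 i p = φ.1 i p) : ψ = φ :=
  Subtype.ext (funext fun i => funext fun p => h i p)

lemma norm_sq_L2Field (ψ : S.L2Field) :
    ‖ψ‖ ^ 2 = ∫ p, ‖ψ.1 (S.index p) p‖ ^ 2 ∂(riemannianVolume m M) := by
  rw [norm_sq_eq_re_inner (𝕜 := ℂ)]
  refine (integral_re (SpinStructure.integrable_fibreInner ψ.2 ψ.2)).symm.trans ?_
  exact integral_congr_ae (.of_forall fun p => (norm_sq_eq_re_inner (𝕜 := ℂ) _).symm)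

lemma integrable_norm_sq (ψ : S.L2Field) :
    Integrable (fun p => ‖ψ.1 (S.index p) p‖ ^ 2) (riemannianVolume m M) := by
  refine (SpinStructure.integrable_fibreInner ψ.2 ψ.2).re.congr (.of_forall fun p => ?_)
  exact (norm_sq_eq_re_inner (𝕜 := ℂ) _).symm

namespace FibreOp

/-- The action `(Tψ)(p) = T(p) ψ(p)` on square integrable spinor fields. -/
def onFields (T : FibreOp S σ) : S.L2Field →ₛₗ[σ] S.L2Field where
  toFun ψ := ⟨fun i p => T.toFun i p (ψ.1 i p), T.isL2Field ψ.2⟩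
  map_add' ψ φ := Subtype.ext (by funext i p; exact map_add (T.toFun i p) _ _)
  map_smul' c ψ := Subtype.ext (by funext i p; exact map_smulₛₗ (T.toFun i p) _ _)

lemma onFields_apply (T : FibreOp S σ) (ψ : S.L2Field) (i : ι) (p : M) :
    (T.onFields ψ).1 i p = T.toFun i p (ψ.1 i p) := rfl

lemma onFields_bounded (T : FibreOp S σ) : ∃ K, ∀ ψ, ‖T.onFields ψ‖ ≤ K * ‖ψ‖ := by
  obtain ⟨K, hK⟩ := T.bounded
  refine ⟨|K|, fun ψ => ?_⟩
  refine (pow_le_pow_iff_left₀ (norm_nonneg _) (by positivity) two_ne_zero).1 ?_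
  rw [mul_pow, sq_abs, norm_sq_L2Field, norm_sq_L2Field, ← integral_const_mul]
  refine integral_mono (integrable_norm_sq _) ((integrable_norm_sq ψ).const_mul _) fun p => ?_
  have h := pow_le_pow_left₀ (norm_nonneg _)
        (hK (S.index p) p (S.mem_index p) (ψ.1 (S.index p) p)) 2
  rw [mul_pow] at h
  exact h

/-- The bounded operator `(Tψ)(p) = T(p) ψ(p)` on `L²(M, S)`. -/
def onL2 (T : FibreOp S σ) : S.L2 →SL[σ] S.L2 :=
  (T.onFields.mkContinuousOfExistsBound T.onFields_bounded).completion

lemma onL2_coe (T : FibreOp S σ) (ψ : S.L2Field) :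
    T.onL2 (ψ : S.L2) = (T.onFields ψ : S.L2Field) :=
  ContinuousLinearMap.completion_apply_coe _ _

end FibreOp

/-- The action of a matrix on spinors. -/
def matAct {m : ℕ} (A : SpinorMat m) : Spinor m →L[ℂ] Spinor m := Matrix.toEuclideanCLM (𝕜 := ℂ) A

lemma matAct_mul {m : ℕ} (A B : SpinorMat m) (x : Spinor m) :
    matAct A (matAct B x) = matAct (A * B) x := by
  rw [matAct, matAct, matAct, map_mul, mul_apply_eq_comp]

lemma matAct_one {m : ℕ} (x : Spinor m) : matAct 1 x = x := by
  rw [matAct, map_one, one_apply_eq_self]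

lemma inner_matAct {m : ℕ} (A : SpinorMat m) (x y : Spinor m) :
    inner ℂ (matAct A x) y = inner ℂ x (matAct A.conjTranspose y) := by
  rw [← ContinuousLinearMap.adjoint_inner_right, ← ContinuousLinearMap.star_eq_adjoint, matAct,
    ← map_star, Matrix.star_eq_conjTranspose, matAct]

/-- Componentwise complex conjugation `x ↦ x̄` of spinors. -/
def conjSpinor (m : ℕ) : Spinor m →ₛₗ[starRingEnd ℂ] Spinor m where
  toFun x := WithLp.toLp 2 fun s => star (x s)
  map_add' x y := by ext s; simp
  map_smul' c x := by ext s; simp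

lemma conjSpinor_conjSpinor {m : ℕ} (x : Spinor m) : conjSpinor m (conjSpinor m x) = x := by
  ext s; simp [conjSpinor]

lemma conjSpinor_matAct {m : ℕ} (A : SpinorMat m) (x : Spinor m) :
    conjSpinor m (matAct A x) = matAct (A.map star) (conjSpinor m x) := by
  ext s
  simp [conjSpinor, matAct, Matrix.mulVec, dotProduct]

lemma norm_conjSpinor {m : ℕ} (x : Spinor m) : ‖conjSpinor m x‖ = ‖x‖ := by
  simp [conjSpinor, EuclideanSpace.norm_eq]

lemma continuous_conjSpinor (m : ℕ) : Continuous (conjSpinor m) :=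
  AddMonoidHomClass.continuous_of_bound (conjSpinor m) 1 fun x => by
    rw [norm_conjSpinor, one_mul]

/-! #### The real structure -/

lemma transpose_charge {m : ℕ} : (chargeMat m).transpose * (chargeMat m).map star = 1 := by
  have h := congrArg Matrix.transpose (chargeMat_unitary' m)
  rw [Matrix.transpose_mul, Matrix.transpose_one] at h
  exact h

lemma charge_transpose {m : ℕ} : chargeMat m * (chargeMat m).transpose.map star = 1 :=
  chargeMat_unitary m

lemma charge_spin {m : ℕ} (h : Spin m) :
    chargeMat m * (spinRep m h).map star = spinRep m h * chargeMat m := by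
  rw [spinRep_charge, spinGroup.involute_eq h.2]

lemma map_star_mul {m : ℕ} (A B : SpinorMat m) : (A * B).map star = A.map star * B.map star := by
  ext; simp [Matrix.mul_apply]

lemma transpose_spin {m : ℕ} (h : Spin m) :
    (chargeMat m).transpose * (spinRep m h).map star = spinRep m h * (chargeMat m).transpose := by
  have h1 : (chargeMat m).map star * spinRep m h =
      (spinRep m h).map star * (chargeMat m).map star := by
    have := congrArg (fun A : SpinorMat m => A.map star) (charge_spin h)
    simp only [map_star_mul] at this
    rw [← this]
    congr 1
    ext; simp
  have h2 : (chargeMat m).map star * (chargeMat m).transpose = 1 :=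
    mul_eq_one_comm.mp transpose_charge
  calc (chargeMat m).transpose * (spinRep m h).map star
      = (chargeMat m).transpose * ((spinRep m h).map star * (chargeMat m).map star) *
          (chargeMat m).transpose := by rw [mul_assoc, mul_assoc, h2, mul_one]
    _ = spinRep m h * (chargeMat m).transpose := by
        rw [← h1, ← mul_assoc, transpose_charge, one_mul]

variable (S)

/-- For a matrix `B` with `B conj(h) = h B` for all `h` in the spin group: the antilinear map
`ψ(p) ↦ B conj(ψ(p))` of spinors. -/
def conjFibreOp (B : SpinorMat m)
    (hB : ∀ h : Spin m, B * (spinRep m h).map star = spinRep m h * B) :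
    FibreOp S (starRingEnd ℂ) where
  toFun _ _ := (matAct B).toLinearMap.comp (conjSpinor m)
  equivariant i j p _ x := by
    change matAct B (conjSpinor m (matAct _ x)) = matAct _ (matAct B (conjSpinor m x))
    rw [conjSpinor_matAct, matAct_mul, matAct_mul, hB]
  measurable i ψ hψ _ :=
    ((matAct B).continuous.comp (continuous_conjSpinor m)).measurable.comp hψ
  bounded := ⟨‖matAct B‖, fun i p _ x => by
    refine ((matAct B).le_opNorm _).trans ?_
    rw [norm_conjSpinor]⟩

lemma conjFibreOp_apply (B : SpinorMat m) (hB) (i : ι) (p : M) (x : Spinor m) :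
    (conjFibreOp S B hB).toFun i p x = matAct B (conjSpinor m x) := rfl

lemma realStructure_left_inv (ψ : S.L2) :
    (conjFibreOp S (chargeMat m).transpose transpose_spin).onL2 ((conjFibreOp S (chargeMat m) charge_spin).onL2 ψ) = ψ := by
  induction ψ using UniformSpace.Completion.induction_on with
  | hp =>
    refine isClosed_eq ?_ continuous_id
    exact (ContinuousLinearMap.continuous _).comp (ContinuousLinearMap.continuous _)
  | ih ψ =>
    have h : (conjFibreOp S (chargeMat m).transpose transpose_spin).onFields
        ((conjFibreOp S (chargeMat m) charge_spin).onFields ψ) = ψ := by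
      refine L2Field_ext fun i p => ?_
      rw [FibreOp.onFields_apply, FibreOp.onFields_apply, conjFibreOp_apply, conjFibreOp_apply,
        conjSpinor_matAct, conjSpinor_conjSpinor, matAct_mul, transpose_charge, matAct_one]
    rw [FibreOp.onL2_coe, FibreOp.onL2_coe, h]

lemma realStructure_right_inv (ψ : S.L2) :
    (conjFibreOp S (chargeMat m) charge_spin).onL2 ((conjFibreOp S (chargeMat m).transpose transpose_spin).onL2 ψ) = ψ := by
  induction ψ using UniformSpace.Completion.induction_on with
  | hp =>
    refine isClosed_eq ?_ continuous_id
    exact (ContinuousLinearMap.continuous _).comp (ContinuousLinearMap.continuous _)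
  | ih ψ =>
    have h : (conjFibreOp S (chargeMat m) charge_spin).onFields
        ((conjFibreOp S (chargeMat m).transpose transpose_spin).onFields ψ) = ψ := by
      refine L2Field_ext fun i p => ?_
      rw [FibreOp.onFields_apply, FibreOp.onFields_apply, conjFibreOp_apply, conjFibreOp_apply,
        conjSpinor_matAct, conjSpinor_conjSpinor, matAct_mul, charge_transpose, matAct_one]
    rw [FibreOp.onL2_coe, FibreOp.onL2_coe, h]

/-- The real structure `𝒥` on `L²(M, S)`: the antiunitary operator `(𝒥ψ)(p) = C conj(ψ(p))`
of charge conjugation, with its inverse `(𝒥⁻¹ψ)(p) = Cᵗ conj(ψ(p))`. -/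
def realStructure : S.L2 ≃SL[starRingEnd ℂ] S.L2 :=
  ContinuousLinearEquiv.equivOfInverse (conjFibreOp S (chargeMat m) charge_spin).onL2
    (conjFibreOp S (chargeMat m).transpose transpose_spin).onL2
    (realStructure_left_inv S) (realStructure_right_inv S)

/-! #### The Dirac matrix `γ^0` -/

/-- A Borel measurable field of unit tangent vectors on `M`. -/
structure UnitField where
  /-- the vector at `p` -/
  toFun : (p : M) → TangentSpace 𝓘(ℝ, ModelSpace m) p
  norm_eq_one : ∀ p, ‖toFun p‖ = 1
  /-- the components in the local frames are measurable on `U i` -/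
  measurable : ∀ i a,
    Measurable ((S.U i).indicator fun p => (inner ℝ (S.frame i a p) (toFun p) : ℝ))

variable {S}

/-- The components of a vector field in the frame `i`. -/
def UnitField.coord (X : UnitField S) (i : ι) (p : M) : Fin (2 * m) → ℝ :=
  fun a => inner ℝ (S.frame i a p) (X.toFun p)

lemma UnitField.expand (X : UnitField S) {j : ι} {p : M} (hj : p ∈ S.U j)
    (v : TangentSpace 𝓘(ℝ, ModelSpace m) p) :
    ∑ a, inner ℝ v (S.frame j a p) * X.coord j p a = inner ℝ v (X.toFun p) := by
  have ho := S.orthonormal_frame j p hj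
  have : FiniteDimensional ℝ (TangentSpace 𝓘(ℝ, ModelSpace m) p) :=
    inferInstanceAs (FiniteDimensional ℝ (ModelSpace m))
  have hcard : Fintype.card (Fin (2 * m)) =
      Module.finrank ℝ (TangentSpace 𝓘(ℝ, ModelSpace m) p) := by
    change _ = Module.finrank ℝ (ModelSpace m)
    simp
  have hb := (OrthonormalBasis.mk ho
    (ho.linearIndependent.span_eq_top_of_card_eq_finrank' hcard).ge).sum_inner_mul_inner v (X.toFun p)
  simp only [OrthonormalBasis.coe_mk] at hb
  exact hb

lemma UnitField.sum_sq (X : UnitField S) {i : ι} {p : M} (hi : p ∈ S.U i) :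
    euclideanForm (2 * m) (X.coord i p) = 1 := by
  have h := X.expand hi (X.toFun p)
  rw [real_inner_self_eq_norm_sq, X.norm_eq_one, one_pow] at h
  rw [← h, euclideanForm, QuadraticMap.weightedSumSquares_apply]
  refine Finset.sum_congr rfl fun a _ => ?_
  rw [one_smul, UnitField.coord, real_inner_comm]

lemma UnitField.equivariant (X : UnitField S) {i j : ι} {p : M} (hp : p ∈ S.U i ∩ S.U j) :
    cliffordMul m (X.coord i p) * spinRep m (S.trans i j p : CliffordAlgebra _) =
      spinRep m (S.trans i j p : CliffordAlgebra _) * cliffordMul m (X.coord j p) := by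
  have h : (S.trans i j p : CliffordAlgebra (euclideanForm (2 * m))) *
        CliffordAlgebra.ι (euclideanForm (2 * m)) (X.coord j p) *
        ((S.trans i j p)⁻¹ : Spin m) =
      CliffordAlgebra.ι (euclideanForm (2 * m)) (X.coord i p) := by
    have h1 : X.coord j p = ∑ a, X.coord j p a • (Pi.single a 1 : Fin (2 * m) → ℝ) :=
      pi_eq_sum_univ' _
    have h2 : X.coord i p = ∑ a, X.coord j p a •
        (fun b => (inner ℝ (S.frame i b p) (S.frame j a p) : ℝ)) := by
      funext b
      rw [Finset.sum_apply, UnitField.coord, ← X.expand hp.2]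
      exact Finset.sum_congr rfl fun a _ => by rw [Pi.smul_apply, smul_eq_mul, mul_comm]
    rw [h2]
    nth_rewrite 1 [h1]
    simp only [map_sum, map_smul, Finset.mul_sum, Finset.sum_mul, mul_smul_comm, smul_mul_assoc]
    exact Finset.sum_congr rfl fun a _ => by rw [S.lift i j p hp a]
  rw [← spinRep_ι, ← spinRep_ι, ← map_mul, ← map_mul, ← h, mul_assoc, ← Submonoid.coe_mul,
    inv_mul_cancel, Submonoid.coe_one, mul_one]

lemma matAct_cliffordMul {m : ℕ} (x : Fin (2 * m) → ℝ) (v : Spinor m) :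
    matAct (cliffordMul m x) v = ∑ a, (x a : ℂ) • matAct (gamma m a) v := by
  simp only [matAct, cliffordMul, LinearMap.coe_mk, AddHom.coe_mk, map_sum, map_smul,
    sum_apply, smul_apply]

/-- Clifford multiplication by a unit vector field `X`: in a local orthonormal frame it is
`∑ₐ ⟨e_a, X⟩ γ^a`. -/
def cliffordFibreOp (X : UnitField S) : FibreOp S (RingHom.id ℂ) where
  toFun i p := (matAct (cliffordMul m (X.coord i p))).toLinearMap
  equivariant i j p hp x := by
    change matAct _ (matAct _ x) = matAct _ (matAct _ x)
    rw [matAct_mul, matAct_mul, X.equivariant hp]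
  measurable i ψ hψ h0 := by
    have h1 : (fun p => (matAct (cliffordMul m (X.coord i p))).toLinearMap (ψ p)) = fun p =>
        ∑ a, (((S.U i).indicator (fun p => X.coord i p a) p : ℝ) : ℂ) •
          matAct (gamma m a) (ψ p) := by
      funext p
      refine (matAct_cliffordMul _ _).trans (Finset.sum_congr rfl fun a _ => ?_)
      by_cases hp : p ∈ S.U i
      · rw [Set.indicator_of_mem hp]
      · rw [h0 p hp, map_zero, smul_zero, smul_zero]
    rw [h1]
    refine Finset.measurable_fun_sum _ fun a _ => ?_
    have h2 : Measurable ((S.U i).indicator fun p => X.coord i p a) :=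
      X.measurable i a
    exact (Complex.measurable_ofReal.comp h2).smul
      ((matAct (gamma m a)).continuous.measurable.comp hψ)
  bounded := ⟨1, fun i p hp x => by
    have h : cliffordMul m (X.coord i p) * cliffordMul m (X.coord i p) = 1 := by
      rw [cliffordMul_sq, X.sum_sq hp, map_one]
    have h2 : ‖matAct (cliffordMul m (X.coord i p)) x‖ ^ 2 = ‖x‖ ^ 2 := by
      rw [norm_sq_eq_re_inner (𝕜 := ℂ), inner_matAct, cliffordMul_conjTranspose, matAct_mul, h,
        matAct_one, ← norm_sq_eq_re_inner]
    rw [one_mul]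
    exact ((pow_left_inj₀ (norm_nonneg _) (norm_nonneg _) two_ne_zero).1 h2).le⟩

/-- The operator `γ^0` on `L²(M, S)`: Clifford multiplication by the first vector field `E₀` of an
orthonormal frame; over the part of `U i` where `E₀ = e_{i,0}` it acts by the matrix `γ^0`. A
measurable frame exists on every `M`, whereas a continuous `E₀` need not exist. -/
def gammaZero (E₀ : UnitField S) : S.L2 →L[ℂ] S.L2 := (cliffordFibreOp E₀).onL2

/-! #### The algebra `C^∞(M) ⊗ ℂ²` -/

instance instContMDiffRingComplex : ContMDiffRing 𝓘(ℝ, ℂ) ∞ ℂ :=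
  { instNormedSpaceLieAddGroup with
    contMDiff_mul := by
      rw [contMDiff_iff]
      refine ⟨continuous_mul, fun x y => ?_⟩
      simp only [mfld_simps, chartAt_self_eq]
      rw [contDiffOn_univ]
      exact contDiff_mul }

variable (m M) in
/-- The algebra `C^∞(M)` of smooth complex valued functions. -/
abbrev SmoothFn : Type _ := C^∞⟮𝓘(ℝ, ModelSpace m), M; 𝓘(ℝ, ℂ), ℂ⟯

variable (m M) in
/-- The algebra `C^∞(M) ⊗ ℂ²`, whose elements are pairs `(f, g)` of smooth functions, with the
componentwise operations. -/
abbrev TwistAlg : Type _ := SmoothFn m M × SmoothFn m M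

/-- The complex conjugate of a smooth function. -/
def SmoothFn.conj (f : SmoothFn m M) : SmoothFn m M :=
  ⟨fun p => star (f p), Complex.conjCLE.contDiff.contMDiff.comp f.contMDiff⟩

namespace TwistAlg

/-- The involution `(f, g)* = (f̄, ḡ)`. -/
def adj (a : TwistAlg m M) : TwistAlg m M := (SmoothFn.conj a.1, SmoothFn.conj a.2)

/-- The twisting automorphism `ρ(f, g) = (g, f)`. -/
def twist (a : TwistAlg m M) : TwistAlg m M := (a.2, a.1)

/-- The twisted involution `a⁺ = ρ(a)*`. -/
def plus (a : TwistAlg m M) : TwistAlg m M := adj (twist a)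

/-- `u` is a `ρ`-unitary of `C^∞(M) ⊗ ℂ²`: `u⁺ u = u u⁺ = 1`. -/
def IsRhoUnitary (u : TwistAlg m M) : Prop := plus u * u = 1 ∧ u * plus u = 1

end TwistAlg

variable (S)

/-- The action of `a = (f, g)` on spinors: multiplication by `f` on the `+1` eigenspace of the grading
`γ` and by `g` on its `-1` eigenspace, i.e. `π(a) = f (1 + γ)/2 + g (1 - γ)/2`. -/
def repFibreOp (a : TwistAlg m M) : FibreOp S (RingHom.id ℂ) where
  toFun _ p := (matAct (a.1 p • ((1 / 2 : ℂ) • (1 + grading m)) +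
    a.2 p • ((1 / 2 : ℂ) • (1 - grading m)))).toLinearMap
  equivariant i j p _ x := by
    change matAct _ (matAct _ x) = matAct _ (matAct _ x)
    have h : grading m * spinRep m (S.trans i j p : CliffordAlgebra (euclideanForm (2 * m))) =
        spinRep m (S.trans i j p : CliffordAlgebra (euclideanForm (2 * m))) * grading m := by
      rw [spinRep_grading, spinGroup.involute_eq (S.trans i j p).2]
    rw [matAct_mul, matAct_mul]
    congr 2
    simp only [add_mul, mul_add, smul_mul_assoc, mul_smul_comm, sub_mul, mul_sub, one_mul, mul_one, h]
  measurable i ψ hψ _ := by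
    have h : (fun p => (matAct (a.1 p • ((1 / 2 : ℂ) • (1 + grading m)) +
        a.2 p • ((1 / 2 : ℂ) • (1 - grading m)))).toLinearMap (ψ p)) = fun p =>
        a.1 p • matAct ((1 / 2 : ℂ) • (1 + grading m)) (ψ p) +
        a.2 p • matAct ((1 / 2 : ℂ) • (1 - grading m)) (ψ p) := by
      funext p
      change matAct _ (ψ p) = _
      simp only [matAct, map_add, map_smul, add_apply, smul_apply]
    rw [h]
    exact (a.1.contMDiff.continuous.measurable.smul ((matAct _).continuous.measurable.comp hψ)).add
      (a.2.contMDiff.continuous.measurable.smul ((matAct _).continuous.measurable.comp hψ))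
  bounded := by
    have hc : Continuous fun p : M => matAct (a.1 p • ((1 / 2 : ℂ) • (1 + grading m)) +
        a.2 p • ((1 / 2 : ℂ) • (1 - grading m))) := by
      have h : (fun p : M => matAct (a.1 p • ((1 / 2 : ℂ) • (1 + grading m)) +
          a.2 p • ((1 / 2 : ℂ) • (1 - grading m)))) = fun p =>
          a.1 p • matAct ((1 / 2 : ℂ) • (1 + grading m)) +
          a.2 p • matAct ((1 / 2 : ℂ) • (1 - grading m)) := by
        funext p
        simp only [matAct, map_add, map_smul]
      rw [h]
      exact (a.1.contMDiff.continuous.smul continuous_const).add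
        (a.2.contMDiff.continuous.smul continuous_const)
    obtain ⟨K, hK⟩ := isCompact_univ.exists_bound_of_continuousOn hc.continuousOn
    exact ⟨K, fun i p _ x => ((matAct _).le_opNorm x).trans
      (mul_le_mul_of_nonneg_right (hK p (Set.mem_univ p)) (norm_nonneg x))⟩

/-- The representation `π` of `C^∞(M) ⊗ ℂ²` on `L²(M, S)`. -/
def rep (a : TwistAlg m M) : S.L2 →L[ℂ] S.L2 := (repFibreOp S a).onL2

/-- The operator `Ad(a) = π(a) 𝒥 π(a) 𝒥⁻¹` on `L²(M, S)`. -/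
def Ad (a : TwistAlg m M) : S.L2 →L[ℂ] S.L2 :=
  (rep S a).comp
    ((realStructure S : S.L2 →SL[starRingEnd ℂ] S.L2).comp
      ((rep S a).comp ((realStructure S).symm : S.L2 →SL[starRingEnd ℂ] S.L2)))

variable {S}

/-- The inner automorphism `ρ(O) = γ^0 O γ^0` of the bounded operators on `L²(M, S)`. -/
def rhoOp (E₀ : UnitField S) (O : S.L2 →L[ℂ] S.L2) : S.L2 →L[ℂ] S.L2 :=
  gammaZero E₀ * O * gammaZero E₀

/-- The twisted adjoint `O⁺ = ρ(O)†`, i.e. the adjoint of `O` with respect to the twisted product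
`(ψ, φ) = ⟨ψ, γ^0 φ⟩`. -/
def plusOp (E₀ : UnitField S) (O : S.L2 →L[ℂ] S.L2) : S.L2 →L[ℂ] S.L2 :=
  ContinuousLinearMap.adjoint (rhoOp E₀ O)

/-- A bounded operator `O` on `L²(M, S)` is `ρ`-unitary if `O⁺ O = O O⁺ = 1`. -/
def IsRhoUnitaryOp (E₀ : UnitField S) (O : S.L2 →L[ℂ] S.L2) : Prop :=
  plusOp E₀ O * O = 1 ∧ O * plusOp E₀ O = 1

end Operators

end TwistedSpin

end

noncomputable section

namespace TwistedSpin

/-! Everything reduces to showing that `Ad(u)` is itself `π(v)` for a `ρ`-unitary `v` of the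
algebra, because `π` carries `ρ`-unitaries to `ρ`-unitary operators.

For the second fact: `γ^0` is Clifford multiplication by a unit vector, so it squares to `1` and,
anticommuting with the grading, exchanges the two chiralities. Hence `γ^0 π(a) γ^0 = π(ρ(a))`. Since
`γ` is self-adjoint, `π(a)† = π(a*)`, and together these give `π(a)⁺ = π(a⁺)` (`plusOp_rep`). As `π`
is also unital and multiplicative, the relations `a⁺a = aa⁺ = 1` are transported to operators
(`isRhoUnitaryOp_rep`).

For the first fact: `C` is a product of `m` Dirac matrices, each anticommuting with `γ`, so `Cγ =
(-1)^m γC` (`chargeMat_grading`). The antilinear operator `𝒥` also conjugates the functions `f` and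
`g`. Therefore `𝒥 π(f, g) 𝒥⁻¹` is `π(f̄, ḡ) = π(a*)` for even `m` and, the chiralities being
exchanged, `π(ḡ, f̄) = π(a⁺)` for odd `m`. So `Ad(u)` is `π(uu*)` or `π(uu⁺)`. In the odd case `uu⁺
= 1` and `Ad(u)` is the identity. In the even case `uu*` is `ρ`-unitary because the `ρ`-unitaries of
this commutative algebra are closed under products and under the involution.

All operator identities are checked as matrix identities in the fibres and extended to the Hilbert
space by density of the spinor fields. -/

/-! ### The matrices `z (1 + γ)/2 + w (1 - γ)/2` -/

/-- The matrix `z (1 + γ)/2 + w (1 - γ)/2`, acting by `z` and `w` on the two chiralities. -/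
def chiralMat (m : ℕ) (z w : ℂ) : SpinorMat m :=
  z • ((1 / 2 : ℂ) • (1 + grading m)) + w • ((1 / 2 : ℂ) • (1 - grading m))

/-- Normal form in the span of `1` and `γ`: products need only `γ² = 1`, and exchanging `z` and `w`
amounts to `γ ↦ -γ`. -/
lemma chiralMat_eq (m : ℕ) (z w : ℂ) :
    chiralMat m z w = ((z + w) / 2) • (1 : SpinorMat m) + ((z - w) / 2) • grading m := by
  rw [chiralMat]; module

lemma chiralMat_one (m : ℕ) : chiralMat m 1 1 = 1 := by
  simp [chiralMat_eq]

/-- `(1 ± γ)/2` are complementary idempotents with product zero, a consequence of `γ² = 1`. -/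
lemma chiralMat_mul (m : ℕ) (z w z' w' : ℂ) :
    chiralMat m z w * chiralMat m z' w' = chiralMat m (z * z') (w * w') := by
  simp only [chiralMat_eq, add_mul, mul_add, smul_mul_smul_comm, one_mul, mul_one, grading_sq]
  module

lemma chiralMat_conjTranspose (m : ℕ) (z w : ℂ) :
    (chiralMat m z w).conjTranspose = chiralMat m (star z) (star w) := by
  simp [chiralMat_eq, Matrix.conjTranspose_add, Matrix.conjTranspose_smul, grading_conjTranspose]

/-- The entries of `γ` are real, so only the scalars are conjugated. This describes the effect of an
antilinear map on `π(a)`. -/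
lemma chiralMat_map_star (m : ℕ) (z w : ℂ) :
    (chiralMat m z w).map star = chiralMat m (star z) (star w) := by
  have h : (chiralMat m z w).map star = ((star z + star w) / 2) • (1 : SpinorMat m).map star +
      ((star z - star w) / 2) • (grading m).map star := by
    ext i j
    by_cases hij : i = j <;> simp [chiralMat_eq, map_ofNat, hij]
  rw [h, one_map_star, grading_star, chiralMat_eq]

/-- Moving `A` across `γ` flips the sign of its coefficient `(z - w)/2`. This is the source of the
twist `ρ`, both for `γ^0` and, in odd `m`, for `𝒥`. -/
lemma chiralMat_mul_of_anticomm {m : ℕ} {A : SpinorMat m}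
    (h : A * grading m = -(grading m * A)) (z w : ℂ) :
    A * chiralMat m z w = chiralMat m w z * A := by
  simp only [chiralMat_eq, add_mul, mul_add, smul_mul_assoc, mul_smul_comm, one_mul, mul_one, h]
  module

lemma chiralMat_mul_of_comm {m : ℕ} {A : SpinorMat m}
    (h : A * grading m = grading m * A) (z w : ℂ) :
    A * chiralMat m z w = chiralMat m z w * A := by
  simp only [chiralMat_eq, add_mul, mul_add, smul_mul_assoc, mul_smul_comm, one_mul, mul_one, h]

/-! ### How the grading commutes with Clifford multiplication and with charge conjugation. -/

lemma cliffordMul_grading (m : ℕ) (x : Fin (2 * m) → ℝ) :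
    cliffordMul m x * grading m = -(grading m * cliffordMul m x) := by
  simp only [cliffordMul, LinearMap.coe_mk, AddHom.coe_mk, Finset.mul_sum, Finset.sum_mul,
    ← Finset.sum_neg_distrib, mul_smul_comm, smul_mul_assoc]
  exact Finset.sum_congr rfl fun a _ => by rw [grading_gamma m a a.2, smul_neg, neg_neg]

/-- Each of the `m` Dirac factors of `C` contributes one sign when `γ` is moved across it. -/
lemma chargeMat_grading (m : ℕ) :
    chargeMat m * grading m = (-1 : ℂ) ^ m • (grading m * chargeMat m) := by
  -- Induction over partial products, with the offset `m % 2` held fixed. The bound `k ≤ m` keeps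
  -- each index `2 * k + m % 2` that occurs below `2 * m`, where the Dirac matrices anticommute with
  -- `γ`.
  have h : ∀ k ≤ m, ((List.range k).map fun k => gamma m (2 * k + m % 2)).prod * grading m =
      (-1 : ℂ) ^ k •
        (grading m * ((List.range k).map fun k => gamma m (2 * k + m % 2)).prod) := by
    intro k hk
    induction k with
    | zero => simp
    | succ k ih =>
      rw [List.range_succ, List.map_append, List.prod_append, List.map_singleton,
        List.prod_singleton, mul_assoc, ← neg_neg (gamma m _ * grading m),
        ← grading_gamma m _ (by omega), mul_neg, ← mul_assoc, ih (by omega), smul_mul_assoc,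
        mul_assoc, pow_succ, mul_neg_one, neg_smul]
  exact h m le_rfl

/-! ### The twisted involution of `C^∞(M) ⊗ ℂ²` -/

namespace TwistAlg

variable {m : ℕ} {M : Type*} [TopologicalSpace M] [ChartedSpace (ModelSpace m) M]

lemma adj_adj (a : TwistAlg m M) : a.adj.adj = a := by
  refine Prod.ext ?_ ?_ <;> ext p
  · exact star_star (a.1 p)
  · exact star_star (a.2 p)

lemma adj_mul (a b : TwistAlg m M) : (a * b).adj = a.adj * b.adj := by
  refine Prod.ext ?_ ?_ <;> ext p
  · exact star_mul' (a.1 p) (b.1 p)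
  · exact star_mul' (a.2 p) (b.2 p)

lemma adj_one : (1 : TwistAlg m M).adj = 1 := by
  refine Prod.ext ?_ ?_ <;> ext p <;> exact star_one ℂ

/-- The algebra is commutative, so the involution preserves the order of factors, and `twist` is
multiplicative by definition. -/
lemma plus_mul (a b : TwistAlg m M) : (a * b).plus = a.plus * b.plus :=
  adj_mul a.twist b.twist

lemma isRhoUnitary_one : IsRhoUnitary (1 : TwistAlg m M) := by
  have h : (1 : TwistAlg m M).plus = 1 := adj_one
  rw [IsRhoUnitary, h, mul_one]
  exact ⟨rfl, rfl⟩

/-- The swap commutes with conjugation, so `(a*)⁺` and `(a⁺)*` agree by definition; conjugating `a⁺a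
= aa⁺ = 1` gives the relations for `a*`. -/
lemma IsRhoUnitary.adj {a : TwistAlg m M} (ha : a.IsRhoUnitary) : a.adj.IsRhoUnitary :=
  ⟨(adj_mul a.plus a).symm.trans ((congrArg TwistAlg.adj ha.1).trans adj_one),
    (adj_mul a a.plus).symm.trans ((congrArg TwistAlg.adj ha.2).trans adj_one)⟩

/-- Commutativity regroups `(a⁺b⁺)(ab)` as `(a⁺a)(b⁺b)`. -/
lemma IsRhoUnitary.mul {a b : TwistAlg m M} (ha : a.IsRhoUnitary) (hb : b.IsRhoUnitary) :
    (a * b).IsRhoUnitary := by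
  rw [IsRhoUnitary, plus_mul, mul_mul_mul_comm, mul_mul_mul_comm a b, ha.1, ha.2, hb.1, hb.2, mul_one]
  exact ⟨rfl, rfl⟩

end TwistAlg

section Operators

variable {m : ℕ} {M : Type*} [TopologicalSpace M] [ChartedSpace (ModelSpace m) M]
  [IsManifold 𝓘(ℝ, ModelSpace m) ∞ M]
  [RiemannianBundle (fun p : M => TangentSpace 𝓘(ℝ, ModelSpace m) p)]
  {ι : Type*} {S : SpinStructure m M ι} [MeasurableSpace M] [BorelSpace M] [CompactSpace M]

/-! ### Operators on `L²(M, S)` that agree on spinor fields -/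

/-- Spinor fields vanish outside `U i` by convention. The restriction to `U i` matters because the
frames, and hence the coordinates of `E₀`, are arbitrary elsewhere. -/
lemma L2Field_ext_on {ψ φ : S.L2Field} (h : ∀ i, ∀ p ∈ S.U i, ψ.1 i p = φ.1 i p) : ψ = φ :=
  L2Field_ext fun i p => by
    by_cases hp : p ∈ S.U i
    · exact h i p hp
    · rw [ψ.2.isSpinorField.1 i p hp, φ.2.isSpinorField.1 i p hp]

/-- The fields are dense in their completion, so continuity reduces operator identities to fibrewise
ones. -/
lemma clm_ext_coe {A B : S.L2 →L[ℂ] S.L2} (h : ∀ ψ : S.L2Field, A ψ = B ψ) : A = B := by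
  refine ContinuousLinearMap.ext fun ψ => ?_
  induction ψ using UniformSpace.Completion.induction_on with
  | hp => exact isClosed_eq A.continuous B.continuous
  | ih ψ => exact h ψ

lemma gammaZero_coe (E₀ : UnitField S) (ψ : S.L2Field) :
    gammaZero E₀ ψ = ((cliffordFibreOp E₀).onFields ψ : S.L2Field) := FibreOp.onL2_coe _ _

lemma cliffordFibreOp_apply (E₀ : UnitField S) (i : ι) (p : M) (x : Spinor m) :
    (cliffordFibreOp E₀).toFun i p x = matAct (cliffordMul m (E₀.coord i p)) x := rfl

/-- The Clifford relation `γ(x)² = |x|²` with `|x| = 1`; the coordinates of `E₀` are normalised only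
over `U i`. -/
lemma gammaZero_sq (E₀ : UnitField S) : gammaZero E₀ * gammaZero E₀ = 1 := by
  refine clm_ext_coe fun ψ => ?_
  change gammaZero E₀ (gammaZero E₀ ψ) = ψ
  rw [gammaZero_coe, gammaZero_coe]
  refine congrArg _ (L2Field_ext_on fun i p hp => ?_)
  rw [FibreOp.onFields_apply, FibreOp.onFields_apply, cliffordFibreOp_apply,
    cliffordFibreOp_apply, matAct_mul, cliffordMul_sq, E₀.sum_sq hp, map_one, matAct_one]

/-! ### The representation `π`: multiplicativity, twist and adjoint. -/

variable (S)

lemma rep_coe (a : TwistAlg m M) (ψ : S.L2Field) :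
    rep S a ψ = ((repFibreOp S a).onFields ψ : S.L2Field) := FibreOp.onL2_coe _ _

lemma repFibreOp_apply (a : TwistAlg m M) (i : ι) (p : M) (x : Spinor m) :
    (repFibreOp S a).toFun i p x = matAct (chiralMat m (a.1 p) (a.2 p)) x := rfl

lemma rep_one : rep S 1 = 1 := by
  refine clm_ext_coe fun ψ => ?_
  change rep S 1 ψ = ψ
  rw [rep_coe]
  refine congrArg _ (L2Field_ext_on fun i p _ => ?_)
  rw [FibreOp.onFields_apply, repFibreOp_apply]
  exact (congrArg (fun A => matAct A (ψ.1 i p)) (chiralMat_one m)).trans (matAct_one _)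

lemma rep_mul (a b : TwistAlg m M) : rep S (a * b) = rep S a * rep S b := by
  refine clm_ext_coe fun ψ => ?_
  change rep S (a * b) ψ = rep S a (rep S b ψ)
  rw [rep_coe, rep_coe, rep_coe]
  refine congrArg _ (L2Field_ext_on fun i p _ => ?_)
  rw [FibreOp.onFields_apply, FibreOp.onFields_apply, FibreOp.onFields_apply, repFibreOp_apply,
    repFibreOp_apply, repFibreOp_apply, matAct_mul, chiralMat_mul]
  rfl

/-- Clifford multiplication by any vector is odd for the grading, so it exchanges the eigenspaces on
which `f` and `g` act. -/
lemma gammaZero_mul_rep (E₀ : UnitField S) (a : TwistAlg m M) :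
    gammaZero E₀ * rep S a = rep S a.twist * gammaZero E₀ := by
  refine clm_ext_coe fun ψ => ?_
  change gammaZero E₀ (rep S a ψ) = rep S a.twist (gammaZero E₀ ψ)
  rw [rep_coe, gammaZero_coe, gammaZero_coe, rep_coe]
  refine congrArg _ (L2Field_ext_on fun i p _ => ?_)
  rw [FibreOp.onFields_apply, FibreOp.onFields_apply, FibreOp.onFields_apply,
    FibreOp.onFields_apply, repFibreOp_apply, repFibreOp_apply, cliffordFibreOp_apply,
    cliffordFibreOp_apply, matAct_mul, matAct_mul,
    chiralMat_mul_of_anticomm (cliffordMul_grading m _)]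
  rfl

lemma rhoOp_rep (E₀ : UnitField S) (a : TwistAlg m M) :
    rhoOp E₀ (rep S a) = rep S a.twist := by
  rw [rhoOp, gammaZero_mul_rep, mul_assoc, gammaZero_sq, mul_one]

/-- The inner product is an integral of fibre products, so the adjoint may be taken fibre by fibre;
`γ` is Hermitian, hence only the scalars are conjugated. -/
lemma inner_onFields_rep (a : TwistAlg m M) (ψ φ : S.L2Field) :
    inner ℂ ((repFibreOp S a).onFields ψ) φ = inner ℂ ψ ((repFibreOp S a.adj).onFields φ) := by
  refine integral_congr_ae (.of_forall fun p => ?_)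
  change inner ℂ (matAct (chiralMat m (a.1 p) (a.2 p)) _) _ = inner ℂ _ (matAct (chiralMat m _ _) _)
  rw [inner_matAct, chiralMat_conjTranspose]
  rfl

lemma adjoint_rep (a : TwistAlg m M) : ContinuousLinearMap.adjoint (rep S a) = rep S a.adj := by
  symm
  rw [ContinuousLinearMap.eq_adjoint_iff]
  intro φ ψ
  induction φ, ψ using UniformSpace.Completion.induction_on₂ with
  | hp =>
    refine isClosed_eq ?_ ?_
    · exact ((rep S a.adj).continuous.comp continuous_fst).inner continuous_snd
    · exact continuous_fst.inner ((rep S a).continuous.comp continuous_snd)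
  | ih φ ψ =>
    -- The fibrewise adjoint relation is used for `a.adj`, whose involution is again `a`.
    rw [rep_coe, rep_coe, UniformSpace.Completion.inner_coe, UniformSpace.Completion.inner_coe,
      inner_onFields_rep, TwistAlg.adj_adj]

lemma plusOp_rep (E₀ : UnitField S) (a : TwistAlg m M) :
    plusOp E₀ (rep S a) = rep S a.plus := by
  rw [plusOp, rhoOp_rep, adjoint_rep, TwistAlg.plus]

/-- `π` is unital, multiplicative and intertwines the two twisted involutions, so it preserves the
defining relations. -/
lemma isRhoUnitaryOp_rep (E₀ : UnitField S) {a : TwistAlg m M} (ha : a.IsRhoUnitary) :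
    IsRhoUnitaryOp E₀ (rep S a) := by
  rw [IsRhoUnitaryOp, plusOp_rep, ← rep_mul, ← rep_mul, ha.1, ha.2, rep_one]
  exact ⟨rfl, rfl⟩

/-! ### Conjugation by the real structure -/

/-- If the charge conjugation matrix intertwines `π(ā)` and `π(b)`, then `𝒥 π(a) 𝒥⁻¹ = π(b)`. -/
lemma realStructure_comp_rep {a b : TwistAlg m M}
    (h : ∀ p, chargeMat m * chiralMat m (star (a.1 p)) (star (a.2 p)) =
      chiralMat m (b.1 p) (b.2 p) * chargeMat m) (ψ : S.L2) :
    realStructure S (rep S a ((realStructure S).symm ψ)) = rep S b ψ := by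
  -- It is enough that `𝒥 π(a) = π(b) 𝒥`, which avoids the formula for `𝒥⁻¹`.
  suffices hJ : ∀ φ, realStructure S (rep S a φ) = rep S b (realStructure S φ) by
    rw [hJ, ContinuousLinearEquiv.apply_symm_apply]
  intro φ
  change (conjFibreOp S (chargeMat m) charge_spin).onL2 (rep S a φ) =
    rep S b ((conjFibreOp S (chargeMat m) charge_spin).onL2 φ)
  induction φ using UniformSpace.Completion.induction_on with
  | hp =>
    exact isClosed_eq ((ContinuousLinearMap.continuous _).comp (ContinuousLinearMap.continuous _))
      ((ContinuousLinearMap.continuous _).comp (ContinuousLinearMap.continuous _))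
  | ih φ =>
    rw [rep_coe, FibreOp.onL2_coe, FibreOp.onL2_coe, rep_coe]
    refine congrArg _ (L2Field_ext_on fun i p _ => ?_)
    -- In each fibre, pulling complex conjugation through the matrix of `π(a)` conjugates its
    -- scalars; what remains is the assumed relation with `C`.
    rw [FibreOp.onFields_apply, FibreOp.onFields_apply, FibreOp.onFields_apply,
      FibreOp.onFields_apply, conjFibreOp_apply, conjFibreOp_apply, repFibreOp_apply,
      repFibreOp_apply, conjSpinor_matAct, matAct_mul, matAct_mul, chiralMat_map_star, h]

/-- Here `C` commutes with `γ`, so `𝒥` preserves chirality and conjugates the two functions: `𝒥 π(a)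
𝒥⁻¹ = π(a*)`. -/
lemma Ad_eq_of_even (hm : Even m) (a : TwistAlg m M) : Ad S a = rep S (a * a.adj) := by
  rw [rep_mul]
  refine ContinuousLinearMap.ext fun ψ => congrArg (rep S a) ?_
  refine realStructure_comp_rep S (fun p => ?_) ψ
  refine chiralMat_mul_of_comm ?_ _ _
  rw [chargeMat_grading, hm.neg_one_pow, one_smul]

/-- Here `C` anticommutes with `γ`, so `𝒥` also exchanges the chiralities: `𝒥 π(a) 𝒥⁻¹ = π(a⁺)`. -/
lemma Ad_eq_of_odd (hm : Odd m) (a : TwistAlg m M) : Ad S a = rep S (a * a.plus) := by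
  rw [rep_mul]
  refine ContinuousLinearMap.ext fun ψ => congrArg (rep S a) ?_
  refine realStructure_comp_rep S (fun p => ?_) ψ
  refine chiralMat_mul_of_anticomm ?_ _ _
  rw [chargeMat_grading, hm.neg_one_pow, neg_smul, one_smul]

end Operators

end TwistedSpin

end

/-! ### The theorem, by the parity of `m`. -/

theorem mainTheorem8 {m : ℕ} {M : Type*} [TopologicalSpace M]
    [ChartedSpace (TwistedSpin.ModelSpace m) M]
    [IsManifold 𝓘(ℝ, TwistedSpin.ModelSpace m) ∞ M] [CompactSpace M] [T2Space M]
    [MeasurableSpace M] [BorelSpace M]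
    [RiemannianBundle (fun p : M => TangentSpace 𝓘(ℝ, TwistedSpin.ModelSpace m) p)]
    [IsContMDiffRiemannianBundle 𝓘(ℝ, TwistedSpin.ModelSpace m) ∞ (TwistedSpin.ModelSpace m)
      (fun p : M => TangentSpace 𝓘(ℝ, TwistedSpin.ModelSpace m) p)]
    {ι : Type*} (S : TwistedSpin.SpinStructure m M ι) (E₀ : TwistedSpin.UnitField S)
    (u : TwistedSpin.TwistAlg m M) (hu : u.IsRhoUnitary) :
    TwistedSpin.IsRhoUnitaryOp E₀ (TwistedSpin.Ad S u) := by
  rcases Nat.even_or_odd m with hm | hm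
  · rw [TwistedSpin.Ad_eq_of_even S hm]
    exact TwistedSpin.isRhoUnitaryOp_rep S E₀ (hu.mul hu.adj)
  -- The relation `uu⁺ = 1` turns `Ad(u)` into `π(1)`.
  · rw [TwistedSpin.Ad_eq_of_odd S hm, hu.2]
    exact TwistedSpin.isRhoUnitaryOp_rep S E₀ TwistedSpin.TwistAlg.isRhoUnitary_one
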